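/- Let $\delta\in(0,1)$ and let $d_\delta>0$ be any constant depending only on $\delta$. Then there is a constant $\tilde D_\delta>0$, depending only on $\delta$ (and on the choice of $d_\delta$), such that the following holds for all integers $n\ge 1$, $K\ge1$, every matrix $H\in\mathbb{R}^{n\times K}$ of full rank $K$, every $\gamma\in\mathbb{R}$, every symmetric positive semidefinite $S\in\mathbb{R}^{K\times K}$, and every random matrix $E\in\mathbb{R}^{n\times K}$ whose rows are independent with $E_{i,\cdot}^T\sim\mathcal N_K(0,\gamma^2S)$ for $i=1,\dots,n$. For a symmetric matrix $A$ write $\rho(A)$ and $\rho_{\min}(A)$ for its highest and lowest eigenvalues, $\mathrm{Tr}(A)$ for its trace and, if $A$ is positive definite, $\mathrm{Cond}(A)=\rho(A)/\rho_{\min}(A)$. Let $P_{[H]}$ be the orthogonal projection of $\mathbb{R}^n$ onto the span of the columns of $H$, put $\hat H=H+E$ and $$\alpha=2d_\delta n\gamma^2\rho(S),\qquad P_{[\hat H]_\alpha}=\hat H(\hat H^T\hat H+\alpha I_K)^{-1}\hat H^T,$$ and let $|||\cdot|||$ be the operator norm associated with the Euclidean norm. (The matrix $\hat H^T\hat H+\alpha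 I_K$ is almost surely invertible: either $\alpha>0$, or $\alpha=0$ and then $E=0$ almost surely.) No lower bound on $\rho_{\min}(H^TH)$ is assumed. Then, with probability at least $1-\delta$, $$\frac1n|||P_{[H]}-P_{[\hat H]_\alpha}|||^2\le \tilde D_\delta\,\gamma^2\,\mathrm{Cond}(H^TH)^3\,\frac{\rho(S)}{\rho_{\min}(H^TH)},$$ and likewise, with probability at least $1-\delta$, $$\frac1n|||P_{[H]}-P_{[\hat H]_\alpha}|||^2\le \gamma^2\tilde D_\delta\,\max\left(\mathrm{Cond}(H^TH)^3\,\frac{\rho(S)}{\rho_{\min}(H^TH)},\ \frac{\mathrm{Tr}(S)}{n\,\rho_{\min}(H^TH)}\right).$$ -/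

import Mathlib

open MeasureTheory ProbabilityTheory
open scoped Matrix

noncomputable section

/-- The highest eigenvalue of a symmetric real matrix. -/
def rhoMax {K : ℕ} (A : Matrix (Fin K) (Fin K) ℝ) : ℝ := sSup (spectrum ℝ A)

/-- The lowest eigenvalue of a symmetric real matrix. -/
def rhoMin {K : ℕ} (A : Matrix (Fin K) (Fin K) ℝ) : ℝ := sInf (spectrum ℝ A)

/-- The condition number of a positive definite matrix. -/
def condNumber {K : ℕ} (A : Matrix (Fin K) (Fin K) ℝ) : ℝ := rhoMax A / rhoMin A

/-- The subspace of Euclidean space spanned by the columns of a matrix. -/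
def colSpace {n K : ℕ} (H : Matrix (Fin n) (Fin K) ℝ) :
    Submodule ℝ (EuclideanSpace ℝ (Fin n)) :=
  Submodule.span ℝ (Set.range fun j => WithLp.toLp 2 fun i => H i j)

/-- The orthogonal projection onto the column space of a matrix. -/
def projCol {n K : ℕ} (H : Matrix (Fin n) (Fin K) ℝ) :
    EuclideanSpace ℝ (Fin n) →L[ℝ] EuclideanSpace ℝ (Fin n) :=
  (colSpace H).starProjection

/-- The ridge-regularized projection with parameter `a`, as an operator on Euclidean space. -/
def ridgeProj {n K : ℕ} (H : Matrix (Fin n) (Fin K) ℝ) (a : ℝ) :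
    EuclideanSpace ℝ (Fin n) →L[ℝ] EuclideanSpace ℝ (Fin n) :=
  Matrix.toEuclideanCLM (𝕜 := ℝ)
    (H * (Hᵀ * H + a • (1 : Matrix (Fin K) (Fin K) ℝ))⁻¹ * Hᵀ)

/-- The random matrix `E` has independent rows, each with the centered Gaussian law on `ℝ^K`
with covariance matrix `g ^ 2 • S`. -/
structure IndepGaussianRows {Ω : Type*} [MeasurableSpace Ω] (P : Measure Ω) {n K : ℕ}
    (E : Ω → Matrix (Fin n) (Fin K) ℝ) (g : ℝ) (S : Matrix (Fin K) (Fin K) ℝ) : Prop where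
  posSemidef : S.PosSemidef
  indep : iIndepFun (fun (i : Fin n) ω => (WithLp.toLp 2 (E ω i) : EuclideanSpace ℝ (Fin K))) P
  law : ∀ i : Fin n, HasLaw (fun ω => (WithLp.toLp 2 (E ω i) : EuclideanSpace ℝ (Fin K)))
    (multivariateGaussian 0 (g ^ 2 • S)) P

end

/-! The bound splits into a deterministic perturbation estimate and a Gaussian norm estimate.
Deterministic (`norm_projCol_sub_ridgeProj_sq_le`): let `l` be the lowest eigenvalue of `Hᵀ * H`. If
`4‖E‖² ≤ l`, the error is split along and across the column space of `H`. Across it, only `E`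
contributes, applied to coefficients of norm at most `2‖y‖/√l`. Along it, self-adjointness reduces
the question to how well ridge regression reproduces a vector `H z`, which the optimality of the
ridge solution answers. If `4‖E‖² ≤ l` cannot be guaranteed, the trivial bound `2` on the error is
already good enough. Probabilistic (`le_measure_opNorm_sq_le`): `‖E‖²` is of order `n γ² ρ(S)`, by
an exponential moment averaged over a ball instead of a union bound over a net. The moment is at
most `2 ^ n * 3 ^ K ≤ 6 ^ n`, because full rank forces `K ≤ n`. The factor `1 / n` then cancels `n`.
The cubed condition number is at least `1` and only loosens the bound; the second claim follows from
the first. -/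

open scoped RealInnerProductSpace

/-! ### Extreme eigenvalues and Rayleigh quotients. -/

section Rayleigh

variable {K : ℕ} {A : Matrix (Fin K) (Fin K) ℝ}

lemma le_rhoMax {t : ℝ} (ht : t ∈ spectrum ℝ A) : t ≤ rhoMax A :=
  le_csSup (Matrix.finite_real_spectrum (A := A)).bddAbove ht

lemma rhoMin_le {t : ℝ} (ht : t ∈ spectrum ℝ A) : rhoMin A ≤ t :=
  csInf_le (Matrix.finite_real_spectrum (A := A)).bddBelow ht

lemma spectrum_nonempty_of_isHermitian (hK : 0 < K) (hA : A.IsHermitian) :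
    (spectrum ℝ A).Nonempty := by
  rw [hA.spectrum_real_eq_range_eigenvalues]
  exact ⟨_, ⟨⟨0, hK⟩, rfl⟩⟩

/-- Positivity of `K` matters: on an empty spectrum `sInf` and `sSup` take the default value `0`. -/
lemma rhoMin_mem_spectrum (hK : 0 < K) (hA : A.IsHermitian) : rhoMin A ∈ spectrum ℝ A :=
  (spectrum_nonempty_of_isHermitian hK hA).csInf_mem (Matrix.finite_real_spectrum (A := A))

lemma rhoMax_mem_spectrum (hK : 0 < K) (hA : A.IsHermitian) : rhoMax A ∈ spectrum ℝ A :=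
  (spectrum_nonempty_of_isHermitian hK hA).csSup_mem (Matrix.finite_real_spectrum (A := A))

lemma rhoMin_le_rhoMax (hK : 0 < K) (hA : A.IsHermitian) : rhoMin A ≤ rhoMax A :=
  rhoMin_le (rhoMax_mem_spectrum hK hA)

lemma posSemidef_rhoMax_sub (hA : A.IsHermitian) :
    (algebraMap ℝ (Matrix (Fin K) (Fin K) ℝ) (rhoMax A) - A).PosSemidef := by
  rw [Matrix.posSemidef_iff_isHermitian_and_spectrum_nonneg]
  refine ⟨(by simp [Matrix.IsHermitian, Matrix.algebraMap_eq_diagonal] :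
    (algebraMap ℝ (Matrix (Fin K) (Fin K) ℝ) (rhoMax A)).IsHermitian).sub hA, ?_⟩
  rw [← spectrum.singleton_sub_eq]
  rintro _ ⟨_, rfl, t, ht, rfl⟩
  simpa using le_rhoMax ht

lemma posSemidef_sub_rhoMin (hA : A.IsHermitian) :
    (A - algebraMap ℝ (Matrix (Fin K) (Fin K) ℝ) (rhoMin A)).PosSemidef := by
  rw [Matrix.posSemidef_iff_isHermitian_and_spectrum_nonneg]
  refine ⟨hA.sub (by simp [Matrix.IsHermitian, Matrix.algebraMap_eq_diagonal] :
    (algebraMap ℝ (Matrix (Fin K) (Fin K) ℝ) (rhoMin A)).IsHermitian), ?_⟩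
  rw [← spectrum.sub_singleton_eq]
  rintro _ ⟨t, ht, _, rfl, rfl⟩
  simpa using rhoMin_le ht

lemma dotProduct_mulVec_le_rhoMax (hA : A.IsHermitian) (x : EuclideanSpace ℝ (Fin K)) :
    x ⬝ᵥ A *ᵥ x ≤ rhoMax A * ‖x‖ ^ 2 := by
  have h := (posSemidef_rhoMax_sub hA).dotProduct_mulVec_nonneg x.ofLp
  rw [Matrix.sub_mulVec, dotProduct_sub, sub_nonneg] at h
  refine h.trans_eq ?_
  rw [EuclideanSpace.real_norm_sq_eq]
  simp [Matrix.algebraMap_eq_diagonal, Matrix.mulVec_diagonal, dotProduct, pow_two, Finset.mul_sum,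
    mul_left_comm]

lemma rhoMin_le_dotProduct_mulVec (hA : A.IsHermitian) (x : EuclideanSpace ℝ (Fin K)) :
    rhoMin A * ‖x‖ ^ 2 ≤ x ⬝ᵥ A *ᵥ x := by
  have h := (posSemidef_sub_rhoMin hA).dotProduct_mulVec_nonneg x.ofLp
  rw [Matrix.sub_mulVec, dotProduct_sub, sub_nonneg] at h
  refine Eq.trans_le ?_ h
  rw [EuclideanSpace.real_norm_sq_eq]
  simp [Matrix.algebraMap_eq_diagonal, Matrix.mulVec_diagonal, dotProduct, pow_two, Finset.mul_sum,
    mul_left_comm]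

lemma rhoMax_nonneg (hK : 0 < K) (hA : A.PosSemidef) : 0 ≤ rhoMax A :=
  (Matrix.posSemidef_iff_isHermitian_and_spectrum_nonneg.1 hA).2 (rhoMax_mem_spectrum hK hA.1)

end Rayleigh

/-! ### Ridge regression in inner product spaces and its perturbation. -/

section Ridge

variable {V W : Type*} [NormedAddCommGroup V] [InnerProductSpace ℝ V]
  [NormedAddCommGroup W] [InnerProductSpace ℝ W]
  {A : V →L[ℝ] W} {X : W → V} {a : ℝ}

/-- `X y` solves the normal equations of the ridge regression of `y` on `A`. -/
def IsRidgeSolution (A : V →L[ℝ] W) (a : ℝ) (X : W → V) : Prop :=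
  ∀ y w, ⟪A (X y), A w⟫ + a * ⟪X y, w⟫ = ⟪y, A w⟫

namespace IsRidgeSolution

lemma norm_fit_le (h : IsRidgeSolution A a X) (ha : 0 ≤ a) (y : W) : ‖A (X y)‖ ≤ ‖y‖ := by
  have h1 := h y (X y)
  rw [real_inner_self_eq_norm_sq, real_inner_self_eq_norm_sq] at h1
  have h2 := real_inner_le_norm y (A (X y))
  have h3 : 0 ≤ a * ‖X y‖ ^ 2 := by positivity
  by_contra! h4
  nlinarith [norm_nonneg y, norm_nonneg (A (X y))]

/-- Both sides equal the symmetric form `⟪A ·, A ·⟫ + a * ⟪·, ·⟫` at `X y`, `X z`. -/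
lemma inner_fit_comm (h : IsRidgeSolution A a X) (y z : W) :
    ⟪A (X y), z⟫ = ⟪y, A (X z)⟫ := by
  rw [← h y (X z), real_inner_comm, ← h z (X y), real_inner_comm, real_inner_comm (X y)]

/-- The ridge solution minimizes the penalized least squares criterion. -/
lemma criterion_le (h : IsRidgeSolution A a X) (ha : 0 ≤ a) (y : W) (z : V) :
    ‖y - A (X y)‖ ^ 2 + a * ‖X y‖ ^ 2 ≤ ‖y - A z‖ ^ 2 + a * ‖z‖ ^ 2 := by
  have h1 := h y (X y)
  have h2 := h y z
  -- By the normal equations this quantity is exactly the excess of the criterion at `z`.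
  have h3 : 0 ≤ ‖A (X y) - A z‖ ^ 2 + a * ‖X y - z‖ ^ 2 := by positivity
  rw [norm_sub_sq_real, norm_sub_sq_real] at h3
  rw [norm_sub_sq_real, norm_sub_sq_real]
  rw [real_inner_self_eq_norm_sq, real_inner_self_eq_norm_sq] at h1
  linarith

end IsRidgeSolution

lemma sqrt_mul_norm_le_add {H : V →L[ℝ] W} {l : ℝ} (hl : ∀ v, √l * ‖v‖ ≤ ‖H v‖) (v : V) :
    (√l - ‖A - H‖) * ‖v‖ ≤ ‖A v‖ := by
  have h1 := hl v
  have h2 := (A - H).le_opNorm v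
  have h3 : ‖H v‖ ≤ ‖A v‖ + ‖(A - H) v‖ := by
    rw [sub_apply]
    calc ‖H v‖ = ‖A v - (A v - H v)‖ := by congr 1; abel
      _ ≤ _ := norm_sub_le _ _
  linarith

variable [FiniteDimensional ℝ W]

lemma norm_projection_sub_le_of_small {H : V →L[ℝ] W} {R : W →L[ℝ] W} {l e : ℝ} (hl : 0 < l)
    (hH : ∀ v, √l * ‖v‖ ≤ ‖H v‖) (ha : 0 ≤ a) (hX : IsRidgeSolution A a X)
    (hR : ∀ y, R y = A (X y)) (he : ‖A - H‖ ^ 2 ≤ e) (hel : 4 * e ≤ l) :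
    ‖(LinearMap.range H.toLinearMap).starProjection - R‖ ^ 2 ≤ (5 * e + a) / l := by
  set U := LinearMap.range H.toLinearMap
  have hs : 0 < √l := Real.sqrt_pos.2 hl
  have hs2 : √l ^ 2 = l := Real.sq_sqrt hl.le
  have hsmall : ‖A - H‖ ≤ √l / 2 := by
    apply abs_le_of_sq_le_sq' _ (by positivity) |>.2
    rw [div_pow, hs2]; linarith
  have hrange (v : V) : H v ∈ U := ⟨v, rfl⟩
  -- the part of the error orthogonal to the column space
  have hperp (y : W) : ‖Uᗮ.starProjection (R y)‖ ^ 2 ≤ 4 * e / l * ‖y‖ ^ 2 := by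
    have h1 : Uᗮ.starProjection (R y) = Uᗮ.starProjection ((A - H) (X y)) := by
      rw [hR, sub_apply, map_sub,
        (Submodule.starProjection_apply_eq_zero_iff _).2
          ((Submodule.le_orthogonal_orthogonal _) (hrange (X y))), sub_zero]
    have h2 : ‖Uᗮ.starProjection (R y)‖ ≤ ‖A - H‖ * ‖X y‖ := by
      rw [h1]
      exact (Submodule.norm_starProjection_apply_le _ _).trans ((A - H).le_opNorm _)
    -- Since `‖A - H‖ ≤ √l / 2`, the perturbed map keeps half of the lower bound of `H`.
    have h3 : √l / 2 * ‖X y‖ ≤ ‖y‖ := by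
      refine le_trans ?_ ((sqrt_mul_norm_le_add hH (X y)).trans (hX.norm_fit_le ha y))
      gcongr; linarith
    have h4 : l / 4 * ‖X y‖ ^ 2 ≤ ‖y‖ ^ 2 := by
      have := pow_le_pow_left₀ (by positivity) h3 2
      rw [mul_pow, div_pow, hs2] at this; linarith
    calc ‖Uᗮ.starProjection (R y)‖ ^ 2 ≤ (‖A - H‖ * ‖X y‖) ^ 2 := by gcongr
      _ = ‖A - H‖ ^ 2 * ‖X y‖ ^ 2 := mul_pow ..
      _ ≤ e * ‖X y‖ ^ 2 := by gcongr
      _ = 4 * e / l * (l / 4 * ‖X y‖ ^ 2) := by field_simp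
      _ ≤ 4 * e / l * ‖y‖ ^ 2 := by
        have : 0 ≤ e := (sq_nonneg _).trans he
        gcongr
  -- ridge regression nearly reproduces the column space
  have hrep (w : W) : ‖U.starProjection w - R (U.starProjection w)‖ ^ 2 ≤
      (e + a) / l * ‖w‖ ^ 2 := by
    obtain ⟨z, hz⟩ : U.starProjection w ∈ U := Submodule.starProjection_apply_mem _ _
    replace hz : H z = U.starProjection w := hz
    -- The competitor `z` has residual `(H - A) z`, so only the perturbation and the penalty remain.
    have h1 := hX.criterion_le ha (H z) z
    have h2 : ‖H z - A z‖ ^ 2 ≤ e * ‖z‖ ^ 2 := by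
      rw [norm_sub_rev, ← sub_apply]
      calc _ ≤ (‖A - H‖ * ‖z‖) ^ 2 := by gcongr; exact (A - H).le_opNorm z
        _ = ‖A - H‖ ^ 2 * ‖z‖ ^ 2 := mul_pow ..
        _ ≤ _ := by gcongr
    have h3 : l * ‖z‖ ^ 2 ≤ ‖w‖ ^ 2 := by
      have := pow_le_pow_left₀ (by positivity)
        ((hH z).trans (hz ▸ Submodule.norm_starProjection_apply_le _ _)) 2
      rwa [mul_pow, hs2] at this
    rw [← hz, hR]
    have h5 : 0 ≤ a * ‖X (H z)‖ ^ 2 := by positivity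
    calc _ ≤ (e + a) * ‖z‖ ^ 2 := by linarith
      _ = (e + a) / l * (l * ‖z‖ ^ 2) := by field_simp
      _ ≤ _ := by
        have : 0 ≤ e := (sq_nonneg _).trans he
        gcongr
  have he0 : 0 ≤ e := (sq_nonneg _).trans he
  have hRs (y z : W) : ⟪R y, z⟫ = ⟪y, R z⟫ := by rw [hR, hR, hX.inner_fit_comm]
  -- Duality: `U.starProjection ∘ (1 - R)` is the adjoint of `(1 - R) ∘ U.starProjection`, which
  -- `hrep` bounds.
  have hpar (y : W) : ‖U.starProjection (y - R y)‖ ^ 2 ≤ (e + a) / l * ‖y‖ ^ 2 := by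
    set q := U.starProjection (y - R y) with hq
    have hqq : U.starProjection q = q := by
      rw [hq]; exact Submodule.starProjection_eq_self_iff.2 (Submodule.starProjection_apply_mem _ _)
    have h1 : ‖q‖ ^ 2 = ⟪y, U.starProjection q - R (U.starProjection q)⟫ := by
      rw [hqq, inner_sub_right, ← hRs, ← inner_sub_left, ← real_inner_self_eq_norm_sq]
      conv_lhs => rw [hq, Submodule.inner_starProjection_left_eq_right, ← hq, hqq]
    have h2 : ‖q‖ ^ 2 ≤ ‖y‖ * ‖U.starProjection q - R (U.starProjection q)‖ :=
      h1 ▸ real_inner_le_norm _ _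
    have h3 : (‖q‖ ^ 2) ^ 2 ≤ ‖q‖ ^ 2 * ((e + a) / l * ‖y‖ ^ 2) := by
      calc _ ≤ (‖y‖ * ‖U.starProjection q - R (U.starProjection q)‖) ^ 2 := by gcongr
        _ = ‖y‖ ^ 2 * ‖U.starProjection q - R (U.starProjection q)‖ ^ 2 := mul_pow ..
        _ ≤ ‖y‖ ^ 2 * ((e + a) / l * ‖q‖ ^ 2) := by gcongr; exact hrep q
        _ = _ := by ring
    rcases (sq_nonneg ‖q‖).eq_or_lt with h | h
    · rw [← h]; positivity
    · rw [pow_two (‖q‖ ^ 2)] at h3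
      exact le_of_mul_le_mul_left h3 h
  -- Pythagoras: `e + a` from the parallel part and `4 * e` from the orthogonal one.
  have hfin (y : W) : ‖(U.starProjection - R) y‖ ^ 2 ≤ (5 * e + a) / l * ‖y‖ ^ 2 := by
    rw [Submodule.norm_sq_eq_add_norm_sq_starProjection _ U]
    have h1 : U.starProjection ((U.starProjection - R) y) = U.starProjection (y - R y) := by
      rw [sub_apply, map_sub, map_sub,
        Submodule.starProjection_eq_self_iff.2 (Submodule.starProjection_apply_mem _ _)]
    have h2 : Uᗮ.starProjection ((U.starProjection - R) y) = -Uᗮ.starProjection (R y) := by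
      rw [sub_apply, map_sub,
        (Submodule.starProjection_apply_eq_zero_iff _).2
          ((Submodule.le_orthogonal_orthogonal _) (Submodule.starProjection_apply_mem U y)),
        zero_sub]
    rw [h1, h2, norm_neg]
    calc _ ≤ (e + a) / l * ‖y‖ ^ 2 + 4 * e / l * ‖y‖ ^ 2 := add_le_add (hpar y) (hperp y)
      _ = _ := by ring
  have hb : 0 ≤ (5 * e + a) / l := by positivity
  rw [← Real.le_sqrt (norm_nonneg _) hb]
  refine ContinuousLinearMap.opNorm_le_bound _ (Real.sqrt_nonneg _) fun y => ?_
  apply abs_le_of_sq_le_sq' _ (by positivity) |>.2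
  rw [mul_pow, Real.sq_sqrt hb]
  exact hfin y

lemma norm_projection_sub_le_two {R : W →L[ℝ] W} (U : Submodule ℝ W) (ha : 0 ≤ a)
    (hX : IsRidgeSolution A a X) (hR : ∀ y, R y = A (X y)) :
    ‖U.starProjection - R‖ ≤ 2 := by
  have h1 : ‖R‖ ≤ 1 := ContinuousLinearMap.opNorm_le_bound _ zero_le_one fun y => by
    rw [hR, one_mul]; exact hX.norm_fit_le ha y
  linarith [norm_sub_le U.starProjection R, Submodule.starProjection_norm_le U]

end Ridge

/-! ### Exponential moments and one-dimensional marginals of Gaussian laws. -/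

section Gaussian

open Real

/-- The integral equals `(1 - 2 s v) ^ (-1/2)`, at most `√2` here. -/
lemma lintegral_exp_mul_sq_gaussianReal_le {s : ℝ} {v : NNReal} (h : 4 * (s * v) ≤ 1) :
    ∫⁻ x, ENNReal.ofReal (exp (s * x ^ 2)) ∂(gaussianReal 0 v) ≤ 2 := by
  rcases eq_or_ne v 0 with rfl | hv
  · simp
  have hv0 : (0 : ℝ) < v := by positivity
  set b : ℝ := 1 / (2 * v) - s with hb_def
  have hvb : 1 ≤ 8 * v * b := by
    have : 8 * v * b = 4 - 8 * (s * v) := by rw [hb_def]; field_simp; ring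
    linarith
  have hb : 0 < b := by
    by_contra! hb
    nlinarith [mul_nonneg hv0.le (neg_nonneg.2 hb)]
  rw [gaussianReal_of_var_ne_zero _ hv, lintegral_withDensity_eq_lintegral_mul _
    (measurable_gaussianPDF _ _) (by fun_prop)]
  have hpt (x : ℝ) : (gaussianPDF 0 v * fun x => ENNReal.ofReal (exp (s * x ^ 2))) x =
      ENNReal.ofReal ((√(2 * π * v))⁻¹ * exp (-b * x ^ 2)) := by
    rw [Pi.mul_apply, gaussianPDF_def, ← ENNReal.ofReal_mul (gaussianPDFReal_nonneg _ _ _),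
      gaussianPDFReal_def, mul_assoc, ← exp_add]
    congr 3
    rw [hb_def]; field_simp; ring
  simp_rw [hpt]
  rw [← ofReal_integral_eq_lintegral_ofReal ((integrable_exp_neg_mul_sq hb).const_mul _)
    (Filter.Eventually.of_forall fun x => by positivity), integral_const_mul, integral_gaussian]
  refine ENNReal.ofReal_le_of_le_toReal ?_
  rw [ENNReal.toReal_ofNat, inv_mul_le_iff₀ (by positivity), Real.sqrt_le_left (by positivity),
    mul_pow, Real.sq_sqrt (by positivity), div_le_iff₀ hb]
  nlinarith [pi_pos]

variable {K : ℕ} {T : Matrix (Fin K) (Fin K) ℝ}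

lemma hasLaw_inner_multivariateGaussian (hT : T.PosSemidef) (w : EuclideanSpace ℝ (Fin K)) :
    HasLaw (fun x => ⟪w, x⟫) (gaussianReal 0 (w ⬝ᵥ T *ᵥ w).toNNReal)
      (multivariateGaussian 0 T) where
  aemeasurable := by fun_prop
  map_eq := by
    have h := IsGaussian.map_eq_gaussianReal (μ := multivariateGaussian 0 T) (innerSL ℝ w)
    rw [show ∫ x, innerSL ℝ w x ∂(multivariateGaussian 0 T) = 0 by
      rw [(innerSL ℝ w).integral_comp_id_comm IsGaussian.integrable_id]; simp] at h
    rw [← covarianceBilin_multivariateGaussian (μ := 0) hT,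
      covarianceBilin_self IsGaussian.memLp_two_id]
    simpa [Function.comp_def] using h

end Gaussian

/-! ### Operator norm versus averages over a ball. -/

section OperatorNorm

open Metric

variable {V W : Type*} [NormedAddCommGroup V] [NormedSpace ℝ V] [FiniteDimensional ℝ V]
  [NormedAddCommGroup W] [NormedSpace ℝ W]

lemma exists_norm_le_one_norm_apply_eq (A : V →L[ℝ] W) : ∃ v, ‖v‖ ≤ 1 ∧ ‖A v‖ = ‖A‖ := by
  have := FiniteDimensional.proper ℝ V
  obtain ⟨v, hv, hmax⟩ := (isCompact_closedBall (0 : V) 1).exists_isMaxOn ⟨0, by simp⟩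
    (f := fun v => ‖A v‖) (by fun_prop)
  rw [mem_closedBall_zero_iff] at hv
  refine ⟨v, hv, le_antisymm (A.unit_le_opNorm v hv) ?_⟩
  refine A.opNorm_le_of_unit_norm (norm_nonneg _) fun x hx => hmax ?_
  simp [hx]

/-- The operator norm of a map is controlled by averages over a ball. -/
lemma volume_ball_mul_exp_opNorm_le [MeasurableSpace V] [BorelSpace V] (m : Measure V)
    [m.IsAddHaarMeasure] (A : V →L[ℝ] W) {s : ℝ} (hs : 0 ≤ s) :
    m (ball 0 (1 / 2)) * ENNReal.ofReal (Real.exp (s * ‖A‖ ^ 2 / 4)) ≤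
      ∫⁻ v in ball 0 (3 / 2), ENNReal.ofReal (Real.exp (s * ‖A v‖ ^ 2)) ∂m := by
  -- Within distance `1/2` of a maximizer `v₀`, `‖A v‖` stays above `‖A‖ / 2`; squaring gives the
  -- factor `1/4`.
  obtain ⟨v₀, hv₀, hA⟩ := exists_norm_le_one_norm_apply_eq A
  have hsub : ball v₀ (1 / 2) ⊆ ball 0 (3 / 2) := ball_subset_ball' (by
    rw [dist_zero_right]; linarith)
  calc _ = ∫⁻ v in ball v₀ (1 / 2), ENNReal.ofReal (Real.exp (s * ‖A‖ ^ 2 / 4)) ∂m := by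
        rw [setLIntegral_const, Measure.addHaar_ball_center m v₀, mul_comm]
    _ ≤ ∫⁻ v in ball v₀ (1 / 2), ENNReal.ofReal (Real.exp (s * ‖A v‖ ^ 2)) ∂m := by
        refine setLIntegral_mono' measurableSet_ball fun v hv => ?_
        have h1 : ‖A v₀ - A v‖ ≤ ‖A‖ * (1 / 2) := by
          rw [← map_sub]
          refine (A.le_opNorm _).trans ?_
          gcongr
          rw [← dist_eq_norm, dist_comm]; exact (mem_ball.1 hv).le
        have h2 : ‖A‖ / 2 ≤ ‖A v‖ := by
          have := norm_sub_norm_le (A v₀) (A v)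
          linarith
        refine ENNReal.ofReal_le_ofReal (Real.exp_le_exp.2 ?_)
        calc s * ‖A‖ ^ 2 / 4 = s * (‖A‖ / 2) ^ 2 := by ring
          _ ≤ _ := by gcongr
    _ ≤ _ := lintegral_mono_set hsub

end OperatorNorm

/-- The operator between Euclidean spaces given by a rectangular matrix. -/
noncomputable def euclOp {n K : ℕ} (A : Matrix (Fin n) (Fin K) ℝ) :
    EuclideanSpace ℝ (Fin K) →L[ℝ] EuclideanSpace ℝ (Fin n) :=
  (Matrix.toEuclideanLin A).toContinuousLinearMap

/-! ### Matrices as operators between Euclidean spaces. -/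

section EuclOp

variable {n K : ℕ}

lemma euclOp_apply (A : Matrix (Fin n) (Fin K) ℝ) (v : EuclideanSpace ℝ (Fin K)) :
    euclOp A v = WithLp.toLp 2 (A *ᵥ v) := rfl

lemma euclOp_sub (A B : Matrix (Fin n) (Fin K) ℝ) : euclOp (A - B) = euclOp A - euclOp B := by
  ext v; simp [euclOp_apply, Matrix.sub_mulVec]

lemma euclOp_zero : euclOp (0 : Matrix (Fin n) (Fin K) ℝ) = 0 := by
  ext v; simp [euclOp_apply]

lemma norm_euclOp_apply_sq (A : Matrix (Fin n) (Fin K) ℝ) (v : EuclideanSpace ℝ (Fin K)) :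
    ‖euclOp A v‖ ^ 2 = ∑ i, ⟪v, (WithLp.toLp 2 (A i) : EuclideanSpace ℝ (Fin K))⟫ ^ 2 := by
  rw [EuclideanSpace.real_norm_sq_eq]
  simp [euclOp_apply, Matrix.mulVec, PiLp.inner_apply, dotProduct]

end EuclOp

/-! ### Operator norm of a Gaussian matrix. -/

section GaussianMatrix

variable {Ω : Type*} [MeasurableSpace Ω] {P : Measure Ω} {n K : ℕ}
  {E : Ω → Matrix (Fin n) (Fin K) ℝ} {g : ℝ} {S : Matrix (Fin K) (Fin K) ℝ}

namespace IndepGaussianRows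

/-- The laws only give a.e. measurable rows, while the exchange of integrals below is carried out
for measurable ones. -/
lemma exists_measurable (h : IndepGaussianRows P E g S) :
    ∃ E' : Ω → Matrix (Fin n) (Fin K) ℝ,
      (∀ i, Measurable fun ω => (WithLp.toLp 2 (E' ω i) : EuclideanSpace ℝ (Fin K))) ∧
      IndepGaussianRows P E' g S ∧ ∀ᵐ ω ∂P, E ω = E' ω := by
  have hm i := (h.law i).aemeasurable
  refine ⟨fun ω i => ((hm i).mk _ ω).ofLp, fun i => (hm i).measurable_mk,
    ⟨h.posSemidef, h.indep.congr fun i => (hm i).ae_eq_mk,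
      fun i => (h.law i).congr (hm i).ae_eq_mk.symm⟩, ?_⟩
  filter_upwards [ae_all_iff.2 fun i => (hm i).ae_eq_mk] with ω hω
  funext i
  rw [← hω i]

lemma hasLaw_inner_row (h : IndepGaussianRows P E g S) (v : EuclideanSpace ℝ (Fin K)) (i : Fin n) :
    HasLaw (fun ω => ⟪v, (WithLp.toLp 2 (E ω i) : EuclideanSpace ℝ (Fin K))⟫)
      (gaussianReal 0 (g ^ 2 * (v ⬝ᵥ S *ᵥ v)).toNNReal) P := by
  have := (hasLaw_inner_multivariateGaussian
    (h.posSemidef.smul (sq_nonneg g)) v).fun_comp (h.law i)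
  simpa [Matrix.smul_mulVec] using this

lemma lintegral_exp_norm_apply_le (h : IndepGaussianRows P E g S)
    (hE : ∀ i, Measurable fun ω => (WithLp.toLp 2 (E ω i) : EuclideanSpace ℝ (Fin K)))
    {s : ℝ} {v : EuclideanSpace ℝ (Fin K)} (hs : 4 * (s * (g ^ 2 * (v ⬝ᵥ S *ᵥ v))) ≤ 1) :
    ∫⁻ ω, ENNReal.ofReal (Real.exp (s * ‖euclOp (E ω) v‖ ^ 2)) ∂P ≤ 2 ^ n := by
  simp_rw [norm_euclOp_apply_sq, Finset.mul_sum, Real.exp_sum]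
  simp_rw [ENNReal.ofReal_prod_of_nonneg fun _ _ => (Real.exp_pos _).le]
  rw [lintegral_prod_eq_prod_lintegral_of_indepFun]
  · refine (Finset.prod_le_prod' (g := fun _ => 2) fun i _ => ?_).trans_eq (by simp)
    have hl := h.hasLaw_inner_row v i
    have h0 : 0 ≤ g ^ 2 * (v ⬝ᵥ S *ᵥ v) :=
      mul_nonneg (sq_nonneg g) (h.posSemidef.dotProduct_mulVec_nonneg v.ofLp)
    refine le_trans (Eq.le ?_) (lintegral_exp_mul_sq_gaussianReal_le (s := s)
      (v := (g ^ 2 * (v ⬝ᵥ S *ᵥ v)).toNNReal) (by rwa [Real.coe_toNNReal _ h0]))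
    rw [← hl.map_eq, lintegral_map' (by fun_prop) hl.aemeasurable]
  · exact h.indep.comp (fun _ x => ENNReal.ofReal (Real.exp (s * ⟪v, x⟫ ^ 2)))
      fun _ => by fun_prop
  · intro i
    have := hE i
    fun_prop

/-- Average the fixed-vector bound over the ball of radius `3/2`. The volume ratio to the ball of
radius `1/2` gives `3 ^ K`, and `9 = 4 * (3/2) ^ 2`. -/
lemma lintegral_exp_opNorm_le [IsProbabilityMeasure P] (h : IndepGaussianRows P E g S)
    (hE : ∀ i, Measurable fun ω => (WithLp.toLp 2 (E ω i) : EuclideanSpace ℝ (Fin K)))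
    {s : ℝ} (hs0 : 0 ≤ s) (hs : 9 * (s * (g ^ 2 * rhoMax S)) ≤ 1) :
    ∫⁻ ω, ENNReal.ofReal (Real.exp (s * ‖euclOp (E ω)‖ ^ 2 / 4)) ∂P ≤ 2 ^ n * 3 ^ K := by
  set m : Measure (EuclideanSpace ℝ (Fin K)) := volume
  have hpos : m (Metric.ball 0 (1 / 2)) ≠ 0 := (Metric.measure_ball_pos m 0 (by norm_num)).ne'
  have hfin : m (Metric.ball 0 (1 / 2)) ≠ ⊤ := measure_ball_lt_top.ne
  have hvol : m (Metric.ball 0 (3 / 2)) = 3 ^ K * m (Metric.ball 0 (1 / 2)) := by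
    have := Measure.addHaar_ball_mul_of_pos m 0 (r := 3) (by norm_num) (1 / 2)
    rw [show (3 : ℝ) * (1 / 2) = 3 / 2 by norm_num] at this
    rw [this]
    simp [ENNReal.ofReal_pow]
  rw [← ENNReal.mul_le_mul_iff_right hpos hfin]
  rw [← lintegral_const_mul' _ _ hfin]
  calc _ ≤ ∫⁻ ω, ∫⁻ v in Metric.ball 0 (3 / 2),
        ENNReal.ofReal (Real.exp (s * ‖euclOp (E ω) v‖ ^ 2)) ∂m ∂P :=
      lintegral_mono fun ω => volume_ball_mul_exp_opNorm_le m _ hs0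
    _ = ∫⁻ v in Metric.ball 0 (3 / 2), ∫⁻ ω,
        ENNReal.ofReal (Real.exp (s * ‖euclOp (E ω) v‖ ^ 2)) ∂P ∂m := by
      refine lintegral_lintegral_swap (Measurable.aemeasurable ?_)
      simp_rw [Function.uncurry_def, norm_euclOp_apply_sq]
      have hE' i : Measurable fun x : Ω × EuclideanSpace ℝ (Fin K) =>
        (WithLp.toLp 2 (E x.1 i) : EuclideanSpace ℝ (Fin K)) := (hE i).comp measurable_fst
      have hin i : Measurable fun x : Ω × EuclideanSpace ℝ (Fin K) =>
        ⟪x.2, (WithLp.toLp 2 (E x.1 i) : EuclideanSpace ℝ (Fin K))⟫ := measurable_snd.inner (hE' i)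
      exact ENNReal.measurable_ofReal.comp (Real.measurable_exp.comp
        ((Finset.measurable_sum _ fun i _ => (hin i).pow_const 2).const_mul s))
    _ ≤ ∫⁻ v in Metric.ball 0 (3 / 2), 2 ^ n ∂m := by
      refine setLIntegral_mono' measurableSet_ball fun v hv => h.lintegral_exp_norm_apply_le hE ?_
      have h1 := dotProduct_mulVec_le_rhoMax h.posSemidef.1 v
      have h2 : ‖v‖ ^ 2 ≤ 9 / 4 := by
        have := mem_ball_zero_iff.1 hv
        nlinarith [norm_nonneg v]
      rcases K.eq_zero_or_pos with rfl | hK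
      · simp [dotProduct]
      have h3 : v ⬝ᵥ S *ᵥ v ≤ rhoMax S * (9 / 4) :=
        h1.trans (mul_le_mul_of_nonneg_left h2 (rhoMax_nonneg hK h.posSemidef))
      calc 4 * (s * (g ^ 2 * (v ⬝ᵥ S *ᵥ v))) ≤ 4 * (s * (g ^ 2 * (rhoMax S * (9 / 4)))) := by gcongr
        _ = 9 * (s * (g ^ 2 * rhoMax S)) := by ring
        _ ≤ 1 := hs
    _ = _ := by rw [setLIntegral_const, hvol]; ring

lemma aemeasurable_opNorm (h : IndepGaussianRows P E g S) :
    AEMeasurable (fun ω => ‖euclOp (E ω)‖) P := by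
  have hc : Continuous fun A : Fin n → Fin K → ℝ => ‖euclOp (Matrix.of A)‖ :=
    (LinearMap.continuous_of_finiteDimensional
      ((LinearMap.toContinuousLinearMap.toLinearMap ∘ₗ Matrix.toEuclideanLin.toLinearMap) ∘ₗ
        (Matrix.ofLinearEquiv ℝ).toLinearMap : (Fin n → Fin K → ℝ) →ₗ[ℝ]
          (EuclideanSpace ℝ (Fin K) →L[ℝ] EuclideanSpace ℝ (Fin n)))).norm
  have hm : AEMeasurable (fun ω i => (E ω i : Fin K → ℝ)) P := aemeasurable_pi_lambda _ fun i =>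
    (WithLp.measurable_ofLp 2 (Fin K → ℝ)).comp_aemeasurable (h.law i).aemeasurable
  exact hc.measurable.comp_aemeasurable hm

/-- Covers the degenerate case, where the exponent `1 / (9 * t)` used below is not available. -/
lemma ae_eq_zero (h : IndepGaussianRows P E g S) (h0 : g ^ 2 * rhoMax S = 0) :
    ∀ᵐ ω ∂P, E ω = 0 := by
  have key (i : Fin n) (j : Fin K) : ∀ᵐ ω ∂P, E ω i j = 0 := by
    set v : EuclideanSpace ℝ (Fin K) := EuclideanSpace.single j 1
    have hl := h.hasLaw_inner_row v i
    have hz : g ^ 2 * (v ⬝ᵥ S *ᵥ v) ≤ 0 := by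
      calc _ ≤ g ^ 2 * (rhoMax S * ‖v‖ ^ 2) := by
            gcongr; exact dotProduct_mulVec_le_rhoMax h.posSemidef.1 v
        _ = g ^ 2 * rhoMax S * ‖v‖ ^ 2 := by ring
        _ = 0 := by rw [h0, zero_mul]
    rw [Real.toNNReal_of_nonpos hz, gaussianReal_zero_var] at hl
    have h1 := (hl.ae_iff (p := fun x => x = 0) (by fun_prop)).2 (by simp)
    filter_upwards [h1] with ω hω
    simpa [v, EuclideanSpace.inner_single_left] using hω
  filter_upwards [ae_all_iff.2 fun i => ae_all_iff.2 (key i)] with ω hω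
  ext i j
  exact hω i j

/-- With probability at least `1 - δ`, the operator norm of a Gaussian matrix with at least as many
rows as columns is of the order of the square root of the number of rows. -/
lemma le_measure_opNorm_sq_le [IsProbabilityMeasure P] (h : IndepGaussianRows P E g S)
    (hK : 0 < K) (hKn : K ≤ n) {δ : ℝ} (hδ0 : 0 < δ) (hδ1 : δ < 1) :
    ENNReal.ofReal (1 - δ) ≤ P {ω | ‖euclOp (E ω)‖ ^ 2 ≤
      36 * (Real.log 6 - Real.log δ) * (n * g ^ 2 * rhoMax S)} := by
  set C := 36 * (Real.log 6 - Real.log δ)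
  have hn : (1 : ℝ) ≤ n := by exact_mod_cast hK.trans_le hKn
  rcases (mul_nonneg (sq_nonneg g) (rhoMax_nonneg hK h.posSemidef)).eq_or_lt with h0 | hpos
  · calc ENNReal.ofReal (1 - δ) ≤ 1 := ENNReal.ofReal_le_one.2 (by linarith)
      _ = P Set.univ := measure_univ.symm
      _ ≤ _ := measure_mono_ae (by
        filter_upwards [h.ae_eq_zero h0.symm] with ω hω _
        change ‖euclOp (E ω)‖ ^ 2 ≤ _
        rw [hω, euclOp_zero, mul_assoc (n : ℝ), ← h0]
        simp)
  obtain ⟨E', hE', h', hEE'⟩ := h.exists_measurable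
  set t := g ^ 2 * rhoMax S
  have hbad : P {ω | ‖euclOp (E ω)‖ ^ 2 ≤ C * (n * g ^ 2 * rhoMax S)}ᶜ ≤ ENNReal.ofReal δ := by
    -- The largest exponent allowed by the moment bound; with the `1/4` in the exponential it yields
    -- `36 = 4 * 9`.
    set s := 1 / (9 * t)
    have hs : 0 < s := by positivity
    have hst : 9 * (s * t) ≤ 1 := by simp only [s]; field_simp; rfl
    have hint := h'.lintegral_exp_opNorm_le hE' hs.le hst
    have hexp : ∫⁻ ω, ENNReal.ofReal (Real.exp (s * ‖euclOp (E ω)‖ ^ 2 / 4)) ∂P ≤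
        ENNReal.ofReal (6 ^ n) := by
      calc _ = ∫⁻ ω, ENNReal.ofReal (Real.exp (s * ‖euclOp (E' ω)‖ ^ 2 / 4)) ∂P :=
            lintegral_congr_ae (by filter_upwards [hEE'] with ω hω; rw [hω])
        _ ≤ 2 ^ n * 3 ^ K := hint
        _ ≤ 2 ^ n * 3 ^ n := by gcongr; norm_num
        _ = _ := by
          rw [← mul_pow, ENNReal.ofReal_pow (by norm_num)]; norm_num
    have hsub : {ω | ‖euclOp (E ω)‖ ^ 2 ≤ C * (n * g ^ 2 * rhoMax S)}ᶜ ⊆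
        {ω | ENNReal.ofReal (6 ^ n / δ) ≤
          ENNReal.ofReal (Real.exp (s * ‖euclOp (E ω)‖ ^ 2 / 4))} := by
      intro ω hω
      simp only [Set.mem_compl_iff, Set.mem_ofPred_eq, not_le] at hω ⊢
      refine ENNReal.ofReal_le_ofReal ?_
      rw [← Real.log_le_iff_le_exp (by positivity), Real.log_div (by positivity) hδ0.ne',
        Real.log_pow]
      have hlog : Real.log δ ≤ 0 := Real.log_nonpos hδ0.le hδ1.le
      have h1 : s * (C * (n * g ^ 2 * rhoMax S)) / 4 = n * (Real.log 6 - Real.log δ) := by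
        rw [mul_assoc (n : ℝ)]
        change 1 / (9 * t) * (36 * (Real.log 6 - Real.log δ) * (n * t)) / 4 = _
        have : t ≠ 0 := hpos.ne'
        field_simp
        ring
      -- Uses `n ≥ 1` and `log δ ≤ 0`.
      calc _ ≤ n * (Real.log 6 - Real.log δ) := by nlinarith
        _ = s * (C * (n * g ^ 2 * rhoMax S)) / 4 := h1.symm
        _ ≤ _ := by gcongr
    -- Markov's inequality at level `6 ^ n / δ`.
    calc _ ≤ _ := measure_mono hsub
      _ ≤ (∫⁻ ω, ENNReal.ofReal (Real.exp (s * ‖euclOp (E ω)‖ ^ 2 / 4)) ∂P) /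
          ENNReal.ofReal (6 ^ n / δ) := by
        refine meas_ge_le_lintegral_div (.ennreal_ofReal ?_)
          (ENNReal.ofReal_pos.2 (by positivity)).ne' ENNReal.ofReal_ne_top
        have := h.aemeasurable_opNorm
        fun_prop
      _ ≤ ENNReal.ofReal (6 ^ n) / ENNReal.ofReal (6 ^ n / δ) := by gcongr
      _ = ENNReal.ofReal δ := by
        rw [← ENNReal.ofReal_div_of_pos (by positivity)]
        congr 1; field_simp
  rw [ENNReal.ofReal_sub _ hδ0.le, ENNReal.ofReal_one, tsub_le_iff_right]
  calc (1 : ENNReal) = P Set.univ := measure_univ.symm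
    _ ≤ _ := by
      rw [← Set.union_compl_self {ω | ‖euclOp (E ω)‖ ^ 2 ≤ C * (n * g ^ 2 * rhoMax S)}]
      exact (measure_union_le _ _).trans (by gcongr)

end IndepGaussianRows

end GaussianMatrix

/-! ### Matrix form of the perturbation bound. -/

section MatrixRidge

variable {n K : ℕ}

lemma range_euclOp (H : Matrix (Fin n) (Fin K) ℝ) :
    LinearMap.range (euclOp H).toLinearMap = colSpace H := by
  rw [LinearMap.range_eq_map, ← (EuclideanSpace.basisFun (Fin K) ℝ).toBasis.span_eq,
    Submodule.map_span, ← Set.range_comp, colSpace]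
  congr 2
  ext j i
  simp [euclOp_apply]

/-- A zero eigenvalue would leave fewer than `K` nonzero ones, yet their number is the rank. -/
lemma rhoMin_gram_pos (hK : 0 < K) {H : Matrix (Fin n) (Fin K) ℝ} (hH : H.rank = K) :
    0 < rhoMin (Hᵀ * H) := by
  have hpsd : (Hᵀ * H).PosSemidef := Matrix.posSemidef_conjTranspose_mul_self H
  have hmem := rhoMin_mem_spectrum hK hpsd.1
  rw [hpsd.1.spectrum_real_eq_range_eigenvalues] at hmem
  obtain ⟨i, hi⟩ := hmem
  rw [← hi]
  refine lt_of_le_of_ne (hpsd.eigenvalues_nonneg i) fun h0 => ?_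
  have hr := hpsd.1.rank_eq_card_non_zero_eigs
  rw [Matrix.rank_transpose_mul_self, hH] at hr
  have := Fintype.card_subtype_lt (p := fun i => hpsd.1.eigenvalues i ≠ 0) (x := i)
    (not_not.2 h0.symm)
  rw [← hr, Fintype.card_fin] at this
  exact this.false

lemma one_le_condNumber_gram (hK : 0 < K) {H : Matrix (Fin n) (Fin K) ℝ} (hH : H.rank = K) :
    1 ≤ condNumber (Hᵀ * H) := by
  rw [condNumber, one_le_div (rhoMin_gram_pos hK hH)]
  exact rhoMin_le_rhoMax hK (Matrix.posSemidef_conjTranspose_mul_self H).1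

lemma dotProduct_gram_mulVec (H : Matrix (Fin n) (Fin K) ℝ) (x w : EuclideanSpace ℝ (Fin K)) :
    w ⬝ᵥ (Hᵀ * H) *ᵥ x = ⟪euclOp H x, euclOp H w⟫ := by
  simp [euclOp_apply, EuclideanSpace.inner_toLp_toLp, ← Matrix.mulVec_mulVec,
    Matrix.dotProduct_mulVec, Matrix.vecMul_transpose]

lemma sqrt_rhoMin_mul_norm_le (H : Matrix (Fin n) (Fin K) ℝ) (v : EuclideanSpace ℝ (Fin K)) :
    √(rhoMin (Hᵀ * H)) * ‖v‖ ≤ ‖euclOp H v‖ := by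
  have h := rhoMin_le_dotProduct_mulVec (Matrix.posSemidef_conjTranspose_mul_self H).1 v
  rw [Matrix.conjTranspose_eq_transpose_of_trivial, dotProduct_gram_mulVec,
    real_inner_self_eq_norm_sq] at h
  rw [← Real.sqrt_sq (norm_nonneg v), ← Real.sqrt_mul' _ (sq_nonneg _)]
  exact Real.sqrt_le_iff.2 ⟨norm_nonneg _, h⟩

/-- The ridge regression coefficients of `y` on the columns of `A`. -/
noncomputable def ridgeCoeff (A : Matrix (Fin n) (Fin K) ℝ) (a : ℝ)
    (y : EuclideanSpace ℝ (Fin n)) : EuclideanSpace ℝ (Fin K) :=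
  WithLp.toLp 2 ((Aᵀ * A + a • (1 : Matrix (Fin K) (Fin K) ℝ))⁻¹ *ᵥ (Aᵀ *ᵥ y))

lemma ridgeProj_apply (A : Matrix (Fin n) (Fin K) ℝ) (a : ℝ) (y : EuclideanSpace ℝ (Fin n)) :
    ridgeProj A a y = euclOp A (ridgeCoeff A a y) := by
  rw [ridgeProj, euclOp_apply, ridgeCoeff]
  simp only [Matrix.mulVec_mulVec, Matrix.mul_assoc]
  rfl

lemma isRidgeSolution_ridgeCoeff {A : Matrix (Fin n) (Fin K) ℝ} {a : ℝ}
    (hA : IsUnit (Aᵀ * A + a • (1 : Matrix (Fin K) (Fin K) ℝ))) :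
    IsRidgeSolution (euclOp A) a (ridgeCoeff A a) := by
  intro y w
  have h1 : (Aᵀ * A + a • (1 : Matrix (Fin K) (Fin K) ℝ)) *ᵥ (ridgeCoeff A a y).ofLp =
      Aᵀ *ᵥ y := by
    rw [ridgeCoeff, Matrix.mulVec_mulVec,
      Matrix.mul_nonsing_inv _ ((Matrix.isUnit_iff_isUnit_det _).1 hA), Matrix.one_mulVec]
  have h2 := congrArg (w.ofLp ⬝ᵥ ·) h1
  simp only [Matrix.add_mulVec, dotProduct_add, Matrix.smul_mulVec, Matrix.one_mulVec,
    dotProduct_smul, dotProduct_gram_mulVec, smul_eq_mul] at h2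
  rw [EuclideanSpace.inner_eq_star_dotProduct (ridgeCoeff A a y) w,
    EuclideanSpace.inner_eq_star_dotProduct y, star_trivial, star_trivial, h2, euclOp_apply,
    Matrix.dotProduct_mulVec, Matrix.vecMul_transpose]

/-- Two sources of invertibility: the penalty, or injectivity of `A`, which is needed when `a = 0`.
-/
lemma isUnit_gram_add_smul {A : Matrix (Fin n) (Fin K) ℝ} {a : ℝ} (ha : 0 ≤ a)
    (h : 0 < a ∨ ∀ v, euclOp A v = 0 → v = 0) :
    IsUnit (Aᵀ * A + a • (1 : Matrix (Fin K) (Fin K) ℝ)) := by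
  rw [← Matrix.mulVec_injective_iff_isUnit, ← Matrix.coe_mulVecLin, ← LinearMap.ker_eq_bot,
    LinearMap.ker_eq_bot']
  intro x hx
  set v : EuclideanSpace ℝ (Fin K) := WithLp.toLp 2 x
  have h1 := congrArg (v.ofLp ⬝ᵥ ·) hx
  simp only [Matrix.mulVecLin_apply, Matrix.add_mulVec, dotProduct_add, Matrix.smul_mulVec,
    Matrix.one_mulVec, dotProduct_smul, dotProduct_zero, smul_eq_mul] at h1
  have h2 : x ⬝ᵥ x = ‖v‖ ^ 2 := by
    rw [EuclideanSpace.real_norm_sq_eq]; simp [v, dotProduct, pow_two]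
  have h3 := dotProduct_gram_mulVec A v v
  rw [real_inner_self_eq_norm_sq] at h3
  change x ⬝ᵥ (Aᵀ * A) *ᵥ x = _ at h3
  change x ⬝ᵥ (Aᵀ * A) *ᵥ x + a * (x ⬝ᵥ x) = 0 at h1
  rw [h3, h2] at h1
  have h4 : 0 ≤ a * ‖v‖ ^ 2 := by positivity
  have hv : v = 0 := by
    rcases h with ha' | hinj
    · have : ‖v‖ ^ 2 = 0 := by nlinarith [sq_nonneg ‖euclOp A v‖, sq_nonneg ‖v‖]
      simpa using this
    · refine hinj v ?_
      have : ‖euclOp A v‖ ^ 2 = 0 := by nlinarith [sq_nonneg ‖euclOp A v‖]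
      simpa using this
  exact congrArg WithLp.ofLp hv

/-- Deterministic perturbation bound for ridge-regularized projections. -/
lemma norm_projCol_sub_ridgeProj_sq_le {H A : Matrix (Fin n) (Fin K) ℝ} {l a b c e : ℝ}
    (hl : 0 < l) (hH : ∀ v, √l * ‖v‖ ≤ ‖euclOp H v‖) (hb : 0 ≤ b) (hc : 0 < c)
    (ha : a = c * b) (he : ‖euclOp (A - H)‖ ^ 2 ≤ e * b) :
    ‖projCol H - ridgeProj A a‖ ^ 2 ≤ (16 * e + c) * b / l := by
  have ha0 : 0 ≤ a := by rw [ha]; positivity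
  rw [euclOp_sub] at he
  simp only [projCol, ← range_euclOp]
  by_cases hsmall : 4 * (e * b) ≤ l
  · have hinj (v) (hv : euclOp A v = 0) : v = 0 := by
      have h1 := sqrt_mul_norm_le_add (A := euclOp A) hH v
      rw [hv, norm_zero] at h1
      have h2 : ‖euclOp A - euclOp H‖ < √l := by
        rw [Real.lt_sqrt (norm_nonneg _)]
        linarith
      by_contra hv0
      have := mul_pos (sub_pos.2 h2) (norm_pos_iff.2 hv0)
      linarith
    have hX := isRidgeSolution_ridgeCoeff (isUnit_gram_add_smul ha0 (Or.inr hinj))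
    refine (norm_projection_sub_le_of_small hl hH ha0 hX (ridgeProj_apply A a) he hsmall).trans ?_
    rw [ha]
    gcongr
    nlinarith [(sq_nonneg _).trans he]
  -- Here `b > 0`, so the penalty is positive, and `4 < 16 * e * b / l` makes the trivial bound `2`
  -- sufficient.
  · push Not at hsmall
    have hb' : 0 < b := by
      refine hb.lt_of_ne fun h => ?_
      rw [← h] at hsmall
      linarith
    have hX := isRidgeSolution_ridgeCoeff (A := A) (isUnit_gram_add_smul ha0
      (Or.inl (by rw [ha]; positivity)))
    have h2 := norm_projection_sub_le_two (LinearMap.range (euclOp H).toLinearMap) ha0 hX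
      (ridgeProj_apply A a)
    rw [le_div_iff₀ hl]
    have h4 := pow_le_pow_left₀ (norm_nonneg _) h2 2
    nlinarith [mul_pos hc hb']

end MatrixRidge

/-! ### Combination of the deterministic and probabilistic bounds. -/

theorem mainTheorem3 (δ : ℝ) (hδ0 : 0 < δ) (hδ1 : δ < 1) (d : ℝ) (hd : 0 < d) :
    ∃ D : ℝ, 0 < D ∧
      ∀ (n K : ℕ) (_ : 0 < K) (H : Matrix (Fin n) (Fin K) ℝ) (_ : H.rank = K)
        (g : ℝ) (S : Matrix (Fin K) (Fin K) ℝ)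
        (Ω : Type*) [MeasurableSpace Ω] (P : Measure Ω) [IsProbabilityMeasure P]
        (E : Ω → Matrix (Fin n) (Fin K) ℝ) (_ : IndepGaussianRows P E g S)
        (α : ℝ) (_ : α = 2 * d * n * g ^ 2 * rhoMax S),
        (ENNReal.ofReal (1 - δ) ≤
          P {ω | 1 / (n : ℝ) * ‖projCol H - ridgeProj (H + E ω) α‖ ^ 2 ≤
            D * g ^ 2 * condNumber (Hᵀ * H) ^ 3 * (rhoMax S / rhoMin (Hᵀ * H))}) ∧
        (ENNReal.ofReal (1 - δ) ≤
          P {ω | 1 / (n : ℝ) * ‖projCol H - ridgeProj (H + E ω) α‖ ^ 2 ≤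
            g ^ 2 * D * max (condNumber (Hᵀ * H) ^ 3 * (rhoMax S / rhoMin (Hᵀ * H)))
              (S.trace / (n * rhoMin (Hᵀ * H)))}) := by
  set C := 36 * (Real.log 6 - Real.log δ) with hC
  have hC0 : 0 ≤ C := by
    have h1 : Real.log δ ≤ 0 := Real.log_nonpos hδ0.le hδ1.le
    have h2 : 0 ≤ Real.log 6 := Real.log_nonneg (by norm_num)
    rw [hC]; linarith
  -- This is `16 * e + c` of the deterministic bound, with `e = C` and `c = 2 * d`, for `b = n * g ^
  -- 2 * rhoMax S`.
  refine ⟨16 * C + 2 * d, by positivity, ?_⟩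
  intro n K hK H hH g S Ω _ P _ E hE α hα
  have hKn : K ≤ n := hH ▸ H.rank_le_height
  have hn : (0 : ℝ) < n := by exact_mod_cast hK.trans_le hKn
  have hl := rhoMin_gram_pos hK hH
  have hS := rhoMax_nonneg hK hE.posSemidef
  have hcond := one_le_pow₀ (one_le_condNumber_gram hK hH) (n := 3)
  have hgood : {ω | ‖euclOp (E ω)‖ ^ 2 ≤ C * (n * g ^ 2 * rhoMax S)} ⊆
      {ω | 1 / (n : ℝ) * ‖projCol H - ridgeProj (H + E ω) α‖ ^ 2 ≤
        (16 * C + 2 * d) * g ^ 2 * condNumber (Hᵀ * H) ^ 3 *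
          (rhoMax S / rhoMin (Hᵀ * H))} := by
    intro ω hω
    have h1 := norm_projCol_sub_ridgeProj_sq_le (A := H + E ω) (b := n * g ^ 2 * rhoMax S)
      (c := 2 * d) (a := α) hl (sqrt_rhoMin_mul_norm_le H) (by positivity) (by positivity)
      (by rw [hα]; ring) (by simpa using hω)
    calc 1 / (n : ℝ) * ‖projCol H - ridgeProj (H + E ω) α‖ ^ 2
        ≤ 1 / n * ((16 * C + 2 * d) * (n * g ^ 2 * rhoMax S) / rhoMin (Hᵀ * H)) := by gcongr
      _ = (16 * C + 2 * d) * g ^ 2 * 1 * (rhoMax S / rhoMin (Hᵀ * H)) := by field_simp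
      _ ≤ _ := by gcongr
  have hfirst := (hE.le_measure_opNorm_sq_le hK hKn hδ0 hδ1).trans (measure_mono hgood)
  refine ⟨hfirst, hfirst.trans (measure_mono fun ω hω => ?_)⟩
  simp only [Set.mem_ofPred_eq] at hω ⊢
  refine hω.trans ?_
  calc _ = g ^ 2 * (16 * C + 2 * d) *
        (condNumber (Hᵀ * H) ^ 3 * (rhoMax S / rhoMin (Hᵀ * H))) := by ring
    _ ≤ _ := by gcongr; exact le_max_left _ _
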